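/- Let $q$ be a prime power, and let $n,k,l,h$ be integers with $l\ge 0$, $2\le k\le\frac{n-2l-1}{2}$, $n\mid q-1$ and $1\le h\le k-1$. Let $\lambda\in\mathbb F_q^{*}$ with $\operatorname{ord}(\lambda)\mid\frac{q-1}{n}$, and let $\alpha_1,\dots,\alpha_n\in\mathbb F_q$ be all the roots of $x^n-\lambda$ (listed in any order; they are pairwise distinct). Let $v_1,\dots,v_n\in\mathbb F_q$ satisfy $v_i\in\{1,-1\}$ for $k\le i\le n$ and $v_i\in\mathbb F_q\setminus\{-1,0,1\}$ for $1\le i\le k-1$. Let $\boldsymbol\eta=(\eta_0,\dots,\eta_l)\in\mathbb F_q^{l+1}$, and let $$\mathcal C_h=\Big\{\big(v_1f(\alpha_1),\dots,v_nf(\alpha_n)\big)\;\Big|\; f(x)=\sum_{i=0}^{k-1}f_ix^i+f_h\sum_{t=0}^{l}\eta_tx^{k+t},\ f_0,\dots,f_{k-1}\in\mathbb F_q\Big\}\subseteq\mathbb F_q^n .$$ Let $r_{h-1}$ be the coefficient of $x^{h-1}$ in the remainder of $q(x)=x^{h-1}+\sum_{t=0}^{l}\eta_tx^{k+t-1}$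 on division by $g(x)=\prod_{i=1}^{k-1}(x-\alpha_i)$. For a $k$-subset $\mathcal I\subsetneq\{1,\dots,n\}$ write $\prod_{i\in\mathcal I}(x-\alpha_i)=\sum_{j=0}^{k}c_jx^{k-j}$, and put $c_j=0$ for $j>k$. For $t\ge 0$ let $A_{\mathcal I,t}$ be the $(t+1)\times(t+1)$ lower triangular Toeplitz matrix whose first column is $(c_0,c_1,\dots,c_t)^T$, let $\boldsymbol c^{(h)}_t=(c_{k-h},c_{k-h+1},\dots,c_{k-h+t})^T$, and let $\boldsymbol e_{t+1}=(0,\dots,0,1)^T\in\mathbb F_q^{t+1}$. Let $\Phi$ be the set of all nonzero $\boldsymbol\eta\in\mathbb F_q^{l+1}$ such that $$1-\sum_{t=0}^{l}\eta_t\,\boldsymbol e_{t+1}^{T}A_{\mathcal I,t}^{-1}\boldsymbol c^{(h)}_t\neq 0\quad\text{for every $k$-subset }\mathcal I\subsetneq\{1,\dots,n\}.$$ If $r_{h-1}\neq 0$ and $\boldsymbol\eta\in\Phi$, then $\mathcal C_h$ is an LCD MDS code of length $n$ and dimension $k$; that is, $\dim\mathcal C_h=k$, $\mathcal C_h\cap\mathcal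 C_h^{\perp}=\{\boldsymbol 0\}$ for the Euclidean dual $\mathcal C_h^\perp$, and the minimum Hamming distance of $\mathcal C_h$ is $n-k+1$. -/

import Mathlib

open Polynomial

namespace TGRS

noncomputable section

/-! ### Linear codes: dual code, LCD codes, minimum distance, MDS codes -/

/-- The Euclidean dual of a linear code `C ⊆ F ^ n`. -/
def dualCode {F : Type*} [Field F] {n : ℕ} (C : Submodule F (Fin n → F)) :
    Submodule F (Fin n → F) where
  carrier := {y | ∀ x ∈ C, x ⬝ᵥ y = 0}
  add_mem' := by
    intro a b ha hb x hx
    rw [dotProduct_add, ha x hx, hb x hx, add_zero]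
  zero_mem' := by
    intro x _
    exact dotProduct_zero x
  smul_mem' := by
    intro c a ha x hx
    rw [dotProduct_smul, ha x hx, smul_zero]

/-- The Euclidean hull `C ∩ C^⊥` of a linear code. -/
def hull {F : Type*} [Field F] {n : ℕ} (C : Submodule F (Fin n → F)) :
    Submodule F (Fin n → F) :=
  C ⊓ dualCode C

/-- A linear code is (Euclidean) LCD if its hull is zero. -/
def IsLCD {F : Type*} [Field F] {n : ℕ} (C : Submodule F (Fin n → F)) : Prop :=
  hull C = ⊥

/-- The minimum Hamming distance between two distinct codewords
(with the value `0` if there is only one codeword). -/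
def minDist {F : Type*} [Field F] [DecidableEq F] {n : ℕ}
    (C : Submodule F (Fin n → F)) : ℕ :=
  sInf {d | ∃ x ∈ C, ∃ y ∈ C, x ≠ y ∧ hammingDist x y = d}

/-- A linear code with parameters `[n, k, d]` is MDS if it attains the Singleton bound,
`d = n - k + 1`. -/
def IsMDS {F : Type*} [Field F] [DecidableEq F] {n : ℕ}
    (C : Submodule F (Fin n → F)) : Prop :=
  minDist C + Module.finrank F C = n + 1

/-! ### The twisted code with twist set `{0, …, l}` and position set `{h}` -/

/-- The twisted polynomial space: all
`f = ∑_{i < k} f_i x ^ i + f_h ∑_{t ≤ l} η_t x ^ (k + t)` with `f_0, …, f_{k-1} ∈ F`. -/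
def twistedPolys {F : Type*} [Field F] {k l : ℕ} (h : Fin k) (η : Fin (l + 1) → F) :
    Submodule F F[X] where
  carrier := {f | ∃ a : Fin k → F,
    f = ∑ i : Fin k, C (a i) * X ^ (i : ℕ)
      + C (a h) * ∑ t : Fin (l + 1), C (η t) * X ^ (k + (t : ℕ))}
  add_mem' := by
    rintro _ _ ⟨a, rfl⟩ ⟨b, rfl⟩
    refine ⟨a + b, ?_⟩
    simp only [Pi.add_apply, C_add, add_mul, Finset.sum_add_distrib]
    ring
  zero_mem' := ⟨0, by simp⟩
  smul_mem' := by
    rintro c _ ⟨a, rfl⟩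
    refine ⟨c • a, ?_⟩
    simp only [Pi.smul_apply, smul_eq_mul, C_mul, smul_eq_C_mul, mul_add, Finset.mul_sum,
      mul_assoc]

/-- The weighted evaluation `f ↦ (v_1 f(α_1), …, v_n f(α_n))`. -/
def evalMap {F : Type*} [Field F] {n : ℕ} (α v : Fin n → F) : F[X] →ₗ[F] (Fin n → F) where
  toFun f := fun i => v i * f.eval (α i)
  map_add' f g := by
    funext i
    simp [mul_add]
  map_smul' c f := by
    funext i
    simp [mul_left_comm]

/-- The code `C_h` with evaluation points `α`, multipliers `v`, hook `h`
and twist coefficients `η`. -/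
def code {F : Type*} [Field F] {n k l : ℕ} (α v : Fin n → F) (h : Fin k)
    (η : Fin (l + 1) → F) : Submodule F (Fin n → F) :=
  (twistedPolys h η).map (evalMap α v)

/-! ### The set `Φ` -/

/-- The coefficients `c_j` in `∏_{i ∈ I} (x - α_i) = ∑_{j = 0}^{k} c_j x ^ (k - j)`,
where `k = |I|`; `c_j = 0` for `j > k`. -/
def cCoeff {F : Type*} [Field F] {n : ℕ} (α : Fin n → F) (I : Finset (Fin n)) (j : ℕ) : F :=
  if j ≤ I.card then (∏ i ∈ I, (X - C (α i))).coeff (I.card - j) else 0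

/-- The lower triangular Toeplitz matrix with entries `c_{i - j}` for `0 ≤ j ≤ i ≤ t`. -/
def aMatrix {F : Type*} [Field F] {n : ℕ} (α : Fin n → F) (I : Finset (Fin n)) (t : ℕ) :
    Matrix (Fin (t + 1)) (Fin (t + 1)) F :=
  Matrix.of fun i j => if j ≤ i then cCoeff α I ((i : ℕ) - (j : ℕ)) else 0

/-- The vector `(c_{k - r}, c_{k - r + 1}, …, c_{k - r + t})`, where `k = |I|`. -/
def cVec {F : Type*} [Field F] {n : ℕ} (α : Fin n → F) (I : Finset (Fin n)) (r t : ℕ) :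
    Fin (t + 1) → F :=
  fun i => cCoeff α I (I.card - r + (i : ℕ))

/-- The set `Φ` of all nonzero `η` such that
`1 - ∑_{t ≤ l} η_t e_{t+1}ᵀ A_{I,t}⁻¹ c_t^{(h)} ≠ 0` for every `k`-subset
`I ⊊ {1, …, n}`. -/
def Phi {F : Type*} [Field F] {n : ℕ} (k l h : ℕ) (α : Fin n → F) : Set (Fin (l + 1) → F) :=
  {η | η ≠ 0 ∧ ∀ I : Finset (Fin n), I.card = k → I ⊂ Finset.univ →
    1 - ∑ t : Fin (l + 1), η t *
      ((Pi.single (Fin.last (t : ℕ)) (1 : F) : Fin ((t : ℕ) + 1) → F) ⬝ᵥ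
        Matrix.mulVec (aMatrix α I t)⁻¹ (cVec α I h t)) ≠ 0}

/-! ### The coefficient `r_{h-1}` -/

/-- The polynomial `q(x) = x ^ (h - 1) + ∑_{t ≤ l} η_t x ^ (k + t - 1)`. -/
def qPoly {F : Type*} [Field F] {l : ℕ} (k h : ℕ) (η : Fin (l + 1) → F) : F[X] :=
  X ^ (h - 1) + ∑ t : Fin (l + 1), C (η t) * X ^ (k + (t : ℕ) - 1)

/-- The polynomial `g(x) = (x - α_1) ⋯ (x - α_{k-1})`. The points are `α_1, …, α_n`, and `α_j`
is stored at the index `j - 1` of `Fin n`. -/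
def gPoly {F : Type*} [Field F] {n : ℕ} (k : ℕ) (α : Fin n → F) : F[X] :=
  ∏ i ∈ Finset.univ.filter (fun i : Fin n => (i : ℕ) + 1 ≤ k - 1), (X - C (α i))

/-- The coefficient of `x ^ (h - 1)` in `q(x) mod g(x)`. -/
def rCoeff {F : Type*} [Field F] {n l : ℕ} (k h : ℕ) (α : Fin n → F) (η : Fin (l + 1) → F) : F :=
  (qPoly k h η % gPoly k α).coeff (h - 1)

end

end TGRS

/-! MDS: let the twisted polynomial f with coefficient vector a vanish at k of the points, indexed
by I, so f = P Q with P = ∏_{i∈I}(x - α_i) and deg Q ≤ l. By `coeff_prod_mul_eq_sum`, the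
coefficient of x^h in P Q is a combination of the coefficients of x^k, …, x^(k+l), with weights
depending only on I. These top coefficients are a_h η_t, so a_h (1 - ∑ η_t w_t) = 0. Membership in Φ
forces a_h = 0; then deg f < k with k roots, so f = 0.

LCD: since the α_i are the n distinct roots of x^n - λ, summing p(α_i) gives n p(0) whenever deg p <
n. Products of two twisted polynomials have degree at most 2(k+l) < n, and v_i² = 1 for i ≥ k, so
orthogonality becomes n a_0 b_0 = ∑_{i<k} (1 - v_i²) f_b(α_i) f_a(α_i). As r_{h-1} ≠ 0, the values
at α_1, …, α_{k-1} and the constant term are coordinates on the twisted space. The form is diagonal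
with nonzero entries in them, hence nondegenerate. -/

namespace TGRS

/-! ### Roots of x^n - λ and their power sums -/

section RootsOfBinomial

variable {F : Type*} [Field F]

theorem exists_isPrimitiveRoot_of_dvd_card_sub_one [Fintype F] {n : ℕ} (hn : n ∣ Fintype.card F - 1) :
    ∃ ζ : F, IsPrimitiveRoot ζ n := by
  obtain ⟨m, hm⟩ := hn
  obtain ⟨g, hg⟩ := IsCyclic.exists_ofOrder_eq_natCard (α := Fˣ)
  have hcard : Nat.card Fˣ = n * m := by
    classical
    rw [Nat.card_eq_fintype_card, Fintype.card_units, hm]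
  have hprim : IsPrimitiveRoot g (n * m) := by
    rw [← hcard, ← hg]; exact IsPrimitiveRoot.orderOf g
  have hpos : 0 < n * m := hcard ▸ Nat.card_pos
  exact ⟨_, (IsPrimitiveRoot.coe_units_iff (ζ := g ^ m)).2
    (hprim.pow hpos (mul_comm n m))⟩

/-- With λ = g^j for a generator g and q - 1 = n m, the order condition gives n m ∣ j m, hence n ∣
j. -/
theorem exists_pow_eq_of_orderOf_dvd [Fintype F] {n : ℕ} (hn : n ∣ Fintype.card F - 1) {lam : F}
    (hlam : lam ≠ 0) (hord : orderOf lam ∣ (Fintype.card F - 1) / n) : ∃ x : F, x ^ n = lam := by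
  obtain ⟨m, hm⟩ := hn
  obtain ⟨g, hg⟩ := IsCyclic.exists_ofOrder_eq_natCard (α := Fˣ)
  have hcard : Nat.card Fˣ = n * m := by
    classical
    rw [Nat.card_eq_fintype_card, Fintype.card_units, hm]
  have hpos : 0 < n * m := hcard ▸ Nat.card_pos
  have hnpos : 0 < n := Nat.pos_of_mul_pos_right hpos
  have hmpos : 0 < m := Nat.pos_of_mul_pos_left hpos
  rw [hm, Nat.mul_div_cancel_left _ hnpos] at hord
  have hgen : ∀ y : Fˣ, y ∈ Submonoid.powers g := fun y =>
    mem_powers_iff_mem_zpowers.2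
      (by rw [(Subgroup.eq_top_of_card_eq _ (by rw [Nat.card_zpowers, hg]) :
        Subgroup.zpowers g = ⊤)]; trivial)
  obtain ⟨j, hj⟩ := hgen (Units.mk0 lam hlam)
  have h1 : g ^ (j * m) = 1 := by
    have hj' : g ^ j = Units.mk0 lam hlam := hj
    rw [pow_mul, hj']
    ext
    simpa using orderOf_dvd_iff_pow_eq_one.1 hord
  have h2 : n * m ∣ j * m := by rw [← hcard, ← hg]; exact orderOf_dvd_of_pow_eq_one h1
  obtain ⟨s, rfl⟩ := Nat.dvd_of_mul_dvd_mul_right hmpos h2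
  refine ⟨((g ^ s : Fˣ) : F), ?_⟩
  have hj' : g ^ (n * s) = Units.mk0 lam hlam := hj
  rw [← Units.val_pow_eq_pow_val, ← pow_mul, mul_comm s n, hj', Units.val_mk0]

variable {n : ℕ} {lam : F} {α : Fin n → F}

theorem pow_eq_of_range_eq_roots
    (hα : Set.range α = {x : F | (X ^ n - C lam : F[X]).IsRoot x}) (i : Fin n) :
    α i ^ n = lam := by
  have : α i ∈ {x : F | (X ^ n - C lam : F[X]).IsRoot x} := hα ▸ Set.mem_range_self i
  simpa [sub_eq_zero] using this

theorem exists_eq_of_range_eq_roots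
    (hα : Set.range α = {x : F | (X ^ n - C lam : F[X]).IsRoot x}) {x : F} (hx : x ^ n = lam) :
    ∃ i, α i = x := by
  have : x ∈ {x : F | (X ^ n - C lam : F[X]).IsRoot x} := by simp [hx]
  rwa [← hα] at this

/-- The n distinct roots x ζ^j all occur among the values of α, and a family indexed by n elements
with n distinct values has no repetition. -/
theorem injective_of_range_eq_roots [Fintype F] (hn : n ∣ Fintype.card F - 1) (hlam : lam ≠ 0)
    (hord : orderOf lam ∣ (Fintype.card F - 1) / n)
    (hα : Set.range α = {x : F | (X ^ n - C lam : F[X]).IsRoot x}) :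
    Function.Injective α := by
  classical
  obtain ⟨ζ, hζ⟩ := exists_isPrimitiveRoot_of_dvd_card_sub_one hn
  obtain ⟨x, hx⟩ := exists_pow_eq_of_orderOf_dvd hn hlam hord
  by_cases hn0 : n = 0
  · subst hn0; exact Function.injective_of_subsingleton α
  have hx0 : x ≠ 0 := by
    rintro rfl
    exact hlam (by rw [← hx, zero_pow hn0])
  have hex : ∀ j : Fin n, ∃ i, α i = x * ζ ^ (j : ℕ) := fun j =>
    exists_eq_of_range_eq_roots hα (by
      rw [mul_pow, hx, ← pow_mul, mul_comm (j : ℕ), pow_mul, hζ.pow_eq_one, one_pow, mul_one])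
  choose σ hσ using hex
  have hσi : Function.Injective σ := by
    intro j j' hjj
    have : x * ζ ^ (j : ℕ) = x * ζ ^ (j' : ℕ) := by rw [← hσ, ← hσ, hjj]
    exact Fin.ext (hζ.pow_inj j.2 j'.2 (mul_left_cancel₀ hx0 this))
  have hσs : Function.Surjective σ := Finite.surjective_of_injective hσi
  intro a b hab
  obtain ⟨j, rfl⟩ := hσs a
  obtain ⟨j', rfl⟩ := hσs b
  rw [hσ, hσ] at hab
  rw [Fin.ext (hζ.pow_inj j.2 j'.2 (mul_left_cancel₀ hx0 hab))]

/-- Multiplication by a primitive n-th root of unity ζ permutes the roots, so the sum equals ζ^m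
times itself, while ζ^m ≠ 1. -/
theorem sum_pow_eq_zero_of_range_eq_roots [Fintype F] (hn : n ∣ Fintype.card F - 1)
    (hα : Set.range α = {x : F | (X ^ n - C lam : F[X]).IsRoot x})
    (hinj : Function.Injective α) {m : ℕ} (hm0 : m ≠ 0) (hmn : m < n) :
    ∑ i, α i ^ m = 0 := by
  obtain ⟨ζ, hζ⟩ := exists_isPrimitiveRoot_of_dvd_card_sub_one hn
  have hex : ∀ i : Fin n, ∃ j, α j = ζ * α i := fun i =>
    exists_eq_of_range_eq_roots hα (by
      rw [mul_pow, hζ.pow_eq_one, one_mul, pow_eq_of_range_eq_roots hα])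
  choose σ hσ using hex
  have hσi : Function.Injective σ := by
    intro j j' hjj
    have : ζ * α j = ζ * α j' := by rw [← hσ, ← hσ, hjj]
    exact hinj (mul_left_cancel₀ (hζ.ne_zero (by omega)) this)
  have h1 : ∑ i, α i ^ m = ζ ^ m * ∑ i, α i ^ m := by
    rw [Finset.mul_sum]
    refine (Equiv.sum_comp (Equiv.ofBijective σ (Finite.injective_iff_bijective.1 hσi))
      fun i => α i ^ m).symm.trans ?_
    refine Finset.sum_congr rfl fun i _ => ?_
    rw [Equiv.ofBijective_apply, hσ, mul_pow]
  have h2 : (1 - ζ ^ m) * ∑ i, α i ^ m = 0 := by rw [sub_mul, one_mul, ← h1, sub_self]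
  exact (mul_eq_zero.1 h2).resolve_left (sub_ne_zero.2 (hζ.pow_ne_one_of_pos_of_lt hm0 hmn).symm)

theorem sum_eval_of_range_eq_roots [Fintype F] (hn : n ∣ Fintype.card F - 1)
    (hα : Set.range α = {x : F | (X ^ n - C lam : F[X]).IsRoot x})
    (hinj : Function.Injective α) {p : F[X]} (hp : p.natDegree < n) :
    ∑ i, p.eval (α i) = n * p.coeff 0 := by
  simp_rw [eval_eq_sum_range' hp]
  rw [Finset.sum_comm, Finset.sum_eq_single 0]
  · simp
  · intro m hm hm0
    rw [← Finset.mul_sum, sum_pow_eq_zero_of_range_eq_roots hn hα hinj hm0 (Finset.mem_range.1 hm),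
      mul_zero]
  · intro h0
    exact absurd (Finset.mem_range.2 (by omega)) h0

/-- n divides q - 1, which is -1 in F. -/
theorem natCast_ne_zero_of_dvd_card_sub_one [Fintype F] (hn : n ∣ Fintype.card F - 1) : (n : F) ≠ 0 := by
  obtain ⟨m, hm⟩ := hn
  intro h0
  have hc : ((Fintype.card F - 1 : ℕ) : F) = 0 := by rw [hm, Nat.cast_mul, h0, zero_mul]
  rw [Nat.cast_sub Fintype.card_pos, FiniteField.cast_card_eq_zero] at hc
  simp at hc

end RootsOfBinomial

/-! ### Toeplitz systems as power series division -/

section Vanishing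

variable {F : Type*} [Field F] {n : ℕ} (α : Fin n → F) (I : Finset (Fin n))

theorem cCoeff_zero : cCoeff α I 0 = 1 := by
  have h := (monic_prod_of_monic I (fun i => X - C (α i)) fun i _ => monic_X_sub_C _).coeff_natDegree
  rw [natDegree_prod_of_monic _ _ fun i _ => monic_X_sub_C _] at h
  simpa [cCoeff] using h

theorem coeff_prod_eq_cCoeff {j : ℕ} (hj : j ≤ I.card) :
    (∏ i ∈ I, (X - C (α i))).coeff j = cCoeff α I (I.card - j) := by
  rw [cCoeff, if_pos (Nat.sub_le _ _), Nat.sub_sub_self hj]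

theorem cCoeff_eq_zero {j : ℕ} (hj : I.card < j) : cCoeff α I j = 0 := by
  rw [cCoeff, if_neg (by omega)]

theorem coeff_prod_eq_zero {j : ℕ} (hj : I.card < j) :
    (∏ i ∈ I, (X - C (α i))).coeff j = 0 := by
  refine coeff_eq_zero_of_natDegree_lt ?_
  rw [natDegree_prod_of_monic _ _ fun i _ => monic_X_sub_C _]
  simpa using hj

/-- The power series `∑_i c_{k-r+i} X^i` divided by `∑_j c_j X^j`. -/
noncomputable def shiftQuotient (r : ℕ) : PowerSeries F :=
  (PowerSeries.mk (cCoeff α I))⁻¹ * PowerSeries.mk fun i => cCoeff α I (I.card - r + i)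

theorem sum_cCoeff_mul_shiftQuotient (r s : ℕ) :
    ∑ t ∈ Finset.range (s + 1), cCoeff α I (s - t) * PowerSeries.coeff t (shiftQuotient α I r) =
      cCoeff α I (I.card - r + s) := by
  have h : shiftQuotient α I r * PowerSeries.mk (cCoeff α I) =
      PowerSeries.mk fun i => cCoeff α I (I.card - r + i) := by
    rw [shiftQuotient, mul_comm, ← mul_assoc, PowerSeries.mul_inv_cancel, one_mul]
    simp [cCoeff_zero]
  have h' := congrArg (PowerSeries.coeff s) h
  rw [PowerSeries.coeff_mul, Finset.Nat.sum_antidiagonal_eq_sum_range_succ_mk] at h'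
  simp only [PowerSeries.coeff_mk] at h'
  rw [← h']
  exact Finset.sum_congr rfl fun t _ => mul_comm _ _

theorem sum_ite_cCoeff_mul_shiftQuotient (r : ℕ) {s l : ℕ} (hs : s ≤ l) :
    ∑ t ∈ Finset.range (l + 1), (if t ≤ s then cCoeff α I (s - t) else 0) *
      PowerSeries.coeff t (shiftQuotient α I r) = cCoeff α I (I.card - r + s) := by
  rw [← sum_cCoeff_mul_shiftQuotient]
  symm
  refine Finset.sum_subset_zero_on_sdiff (by intro x; simp; omega) ?_ ?_
  · intro t ht
    simp only [Finset.mem_sdiff, Finset.mem_range] at ht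
    rw [if_neg (by omega), zero_mul]
  · intro t ht
    rw [if_pos (by simp at ht; omega)]

theorem isUnit_det_aMatrix (t : ℕ) : IsUnit (aMatrix α I t).det := by
  rw [Matrix.det_of_isLowerTriangular]
  · simp [aMatrix, cCoeff_zero]
  · intro i j hij
    have hij' : i < j := hij
    simp [aMatrix, not_le.2 hij']

/-- The Toeplitz matrix is multiplication by ∑ c_j X^j truncated at X^t, so solving with it is power
series division. The solutions for different t are thus truncations of one series. -/
theorem aMatrix_inv_mulVec_cVec (r t : ℕ) :
    Matrix.mulVec (aMatrix α I t)⁻¹ (cVec α I r t) =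
      fun i : Fin (t + 1) => PowerSeries.coeff (i : ℕ) (shiftQuotient α I r) := by
  have h : Matrix.mulVec (aMatrix α I t)
      (fun i => PowerSeries.coeff (i : ℕ) (shiftQuotient α I r)) = cVec α I r t := by
    funext i
    have := sum_ite_cCoeff_mul_shiftQuotient α I r (Nat.lt_succ_iff.1 i.2)
    rw [Finset.sum_range] at this
    rw [cVec, ← this, Matrix.mulVec, dotProduct]
    rfl
  rw [← h, Matrix.mulVec_mulVec, Matrix.nonsing_inv_mul _ (isUnit_det_aMatrix α I t),
    Matrix.one_mulVec]

/-- Both sides are linear in Q. For Q = x^s the claim is the convolution identity defining the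
quotient series. -/
theorem coeff_prod_mul_eq_sum (Q : F[X]) {l r : ℕ} (hQ : Q.natDegree ≤ l) (hr : r ≤ I.card) :
    ((∏ i ∈ I, (X - C (α i))) * Q).coeff r = ∑ t ∈ Finset.range (l + 1),
      ((∏ i ∈ I, (X - C (α i))) * Q).coeff (I.card + t) *
        PowerSeries.coeff t (shiftQuotient α I r) := by
  have hcoeff : ∀ j, ((∏ i ∈ I, (X - C (α i))) * Q).coeff j = ∑ s ∈ Finset.range (l + 1),
      Q.coeff s * if s ≤ j then (∏ i ∈ I, (X - C (α i))).coeff (j - s) else 0 := by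
    intro j
    conv_lhs => rw [Q.as_sum_range_C_mul_X_pow' (Nat.lt_succ_of_le hQ)]
    rw [Finset.mul_sum, finsetSum_coeff]
    refine Finset.sum_congr rfl fun s _ => ?_
    rw [mul_left_comm, coeff_C_mul, coeff_mul_X_pow']
  have hhigh : ∀ t, ((∏ i ∈ I, (X - C (α i))) * Q).coeff (I.card + t) =
      ∑ s ∈ Finset.range (l + 1), Q.coeff s * if t ≤ s then cCoeff α I (s - t) else 0 := by
    intro t
    rw [hcoeff]
    refine Finset.sum_congr rfl fun s _ => ?_
    congr 1
    by_cases hts : t ≤ s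
    · rw [if_pos hts]
      by_cases hs : s ≤ I.card + t
      · rw [if_pos hs, coeff_prod_eq_cCoeff _ _ (by omega)]
        congr 1
        omega
      · rw [if_neg hs, cCoeff_eq_zero _ _ (by omega)]
    · rw [if_neg hts, if_pos (by omega), coeff_prod_eq_zero _ _ (by omega)]
  simp_rw [hhigh, Finset.sum_mul]
  rw [Finset.sum_comm, hcoeff]
  refine Finset.sum_congr rfl fun s hs => ?_
  simp_rw [mul_assoc]
  rw [← Finset.mul_sum, sum_ite_cCoeff_mul_shiftQuotient _ _ _
    (Nat.lt_succ_iff.1 (Finset.mem_range.1 hs))]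
  congr 1
  -- When s > r, the index `I.card - r + s` exceeds `I.card`, so both sides vanish.
  by_cases hsr : s ≤ r
  · rw [if_pos hsr, coeff_prod_eq_cCoeff _ _ (by omega)]
    congr 1
    omega
  · rw [if_neg hsr, cCoeff_eq_zero _ _ (by omega)]

end Vanishing

/-! ### Coefficients and degrees of twisted polynomials -/

section TwistedPolynomials

variable {F : Type*} [Field F] {k l : ℕ} (h : Fin k) (η : Fin (l + 1) → F)

/-- The twisted polynomial with coefficient vector `a`. -/
noncomputable def twistedPoly : (Fin k → F) →ₗ[F] F[X] where
  toFun a := ∑ i : Fin k, C (a i) * X ^ (i : ℕ)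
      + C (a h) * ∑ t : Fin (l + 1), C (η t) * X ^ (k + (t : ℕ))
  map_add' a b := by
    simp only [Pi.add_apply, C_add, add_mul, Finset.sum_add_distrib]
    ring
  map_smul' c a := by
    simp only [Pi.smul_apply, smul_eq_mul, C_mul, smul_eq_C_mul, mul_add, Finset.mul_sum,
      mul_assoc, RingHom.id_apply]

theorem range_twistedPoly : LinearMap.range (twistedPoly h η) = twistedPolys h η := by
  ext f
  exact ⟨fun ⟨a, ha⟩ => ⟨a, ha.symm⟩, fun ⟨a, ha⟩ => ⟨a, ha.symm⟩⟩

variable (a : Fin k → F)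

theorem coeff_twistedPoly_of_lt (j : Fin k) : (twistedPoly h η a).coeff j = a j := by
  change (∑ i : Fin k, C (a i) * X ^ (i : ℕ)
      + C (a h) * ∑ t : Fin (l + 1), C (η t) * X ^ (k + (t : ℕ))).coeff j = _
  have h1 : ∀ t : Fin (l + 1), (j : ℕ) ≠ k + t := fun t => by omega
  simp [finsetSum_coeff, coeff_X_pow, h1, Fin.val_inj]

theorem coeff_twistedPoly_add (t : ℕ) : (twistedPoly h η a).coeff (k + t) =
    a h * if ht : t < l + 1 then η ⟨t, ht⟩ else 0 := by
  change (∑ i : Fin k, C (a i) * X ^ (i : ℕ)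
      + C (a h) * ∑ t : Fin (l + 1), C (η t) * X ^ (k + (t : ℕ))).coeff (k + t) = _
  have h1 : ∀ i : Fin k, k + t ≠ i := fun i => by omega
  simp only [coeff_add, finsetSum_coeff, coeff_C_mul, coeff_X_pow, h1, if_false, mul_zero,
    Finset.sum_const_zero, zero_add, add_right_inj, mul_ite, mul_one]
  congr 1
  split_ifs with ht
  · rw [Finset.sum_eq_single ⟨t, ht⟩]
    · simp
    · intro b _ hb
      rw [if_neg fun hbt => hb (Fin.ext hbt.symm)]
    · simp
  · refine Finset.sum_eq_zero fun b _ => if_neg ?_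
    omega

theorem natDegree_twistedPoly_le : (twistedPoly h η a).natDegree ≤ k + l := by
  rw [natDegree_le_iff_coeff_eq_zero]
  intro N hN
  obtain ⟨t, rfl⟩ := Nat.exists_eq_add_of_le (show k ≤ N by omega)
  rw [coeff_twistedPoly_add, dif_neg (by omega), mul_zero]

theorem natDegree_twistedPoly_lt (ha : a h = 0) : (twistedPoly h η a).natDegree < k := by
  have hk : 0 < k := h.pos
  suffices (twistedPoly h η a).natDegree ≤ k - 1 by omega
  rw [natDegree_le_iff_coeff_eq_zero]
  intro N hN
  obtain ⟨t, rfl⟩ := Nat.exists_eq_add_of_le (show k ≤ N by omega)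
  rw [coeff_twistedPoly_add, ha, zero_mul]

theorem eq_zero_of_twistedPoly_eq_zero (ha : twistedPoly h η a = 0) : a = 0 := by
  funext j
  rw [← coeff_twistedPoly_of_lt h η a j, ha, coeff_zero, Pi.zero_apply]

end TwistedPolynomials

/-! ### Two criteria for a twisted polynomial to vanish -/

section Zeros

variable {F : Type*} [Field F] {n k l : ℕ} {α : Fin n → F} {h : Fin k} {η : Fin (l + 1) → F}

theorem prod_X_sub_C_dvd_of_eval_eq_zero (hinj : Function.Injective α) {I : Finset (Fin n)}
    {f : F[X]} (hf : ∀ i ∈ I, f.eval (α i) = 0) : ∏ i ∈ I, (X - C (α i)) ∣ f :=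
  Finset.prod_dvd_of_coprime
    (fun _ _ _ _ hij => pairwise_coprime_X_sub_C hinj hij)
    fun i hi => dvd_iff_isRoot.2 (hf i hi)

theorem natDegree_prod_X_sub_C (I : Finset (Fin n)) :
    (∏ i ∈ I, (X - C (α i))).natDegree = I.card := by
  rw [natDegree_prod_of_monic _ _ fun i _ => monic_X_sub_C _]
  simp

theorem eq_zero_of_eval_eq_zero_of_card (hinj : Function.Injective α) (hkn : k < n)
    (hη : η ∈ Phi k l h α) {a : Fin k → F} {I : Finset (Fin n)} (hI : I.card = k)
    (hf : ∀ i ∈ I, (twistedPoly h η a).eval (α i) = 0) : a = 0 := by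
  have hdvd := prod_X_sub_C_dvd_of_eval_eq_zero hinj hf
  have hss : I ⊂ Finset.univ := Finset.ssubset_univ_iff.2 fun hu => by
    rw [hu, Finset.card_univ, Fintype.card_fin] at hI
    omega
  have hcond := hη.2 I hI hss
  simp_rw [aMatrix_inv_mulVec_cVec, single_dotProduct, one_mul, Fin.val_last] at hcond
  have hah : a h = 0 := by
    by_contra hah
    apply hcond
    have hne : twistedPoly h η a ≠ 0 := fun h0 => hah (by
      rw [eq_zero_of_twistedPoly_eq_zero h η a h0, Pi.zero_apply])
    obtain ⟨Q, hQ⟩ := hdvd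
    have hQ0 : Q ≠ 0 := by
      rintro rfl
      exact hne (by rw [hQ, mul_zero])
    have hdeg : Q.natDegree ≤ l := by
      have h1 := natDegree_twistedPoly_le h η a
      rw [hQ, natDegree_mul (monic_prod_of_monic I _ fun i _ => monic_X_sub_C _).ne_zero hQ0,
        natDegree_prod_X_sub_C, hI] at h1
      omega
    have hkey := coeff_prod_mul_eq_sum α I Q hdeg (r := h) (by omega)
    rw [← hQ, coeff_twistedPoly_of_lt, hI, Finset.sum_range] at hkey
    simp_rw [coeff_twistedPoly_add, Fin.is_lt, dif_pos, Fin.eta, mul_assoc] at hkey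
    rw [← Finset.mul_sum] at hkey
    rw [sub_eq_zero]
    exact mul_left_cancel₀ hah (by rw [mul_one]; exact hkey)
  refine eq_zero_of_twistedPoly_eq_zero h η a (eq_zero_of_dvd_of_natDegree_lt hdvd ?_)
  rw [natDegree_prod_X_sub_C, hI]
  exact natDegree_twistedPoly_lt h η a hah

theorem natDegree_gPoly (hkn : k ≤ n) : (gPoly k α).natDegree = k - 1 := by
  rw [gPoly, natDegree_prod_X_sub_C]
  have : (Finset.univ.filter fun i : Fin n => (i : ℕ) + 1 ≤ k - 1) =
      Finset.univ.filter fun i : Fin n => (i : ℕ) < k - 1 := by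
    ext i
    simp
  rw [this, Fin.card_filter_val_lt]
  omega

theorem X_mul_qPoly (hh : 1 ≤ (h : ℕ)) :
    X * qPoly k h η = X ^ (h : ℕ) + ∑ t : Fin (l + 1), C (η t) * X ^ (k + (t : ℕ)) := by
  have hk : 0 < k := h.pos
  rw [qPoly, mul_add, Finset.mul_sum, ← pow_succ', Nat.sub_add_cancel hh]
  congr 1
  refine Finset.sum_congr rfl fun t _ => ?_
  rw [mul_left_comm, ← pow_succ', Nat.sub_add_cancel (by omega)]

/-- As f(0) = 0 and no α_i is zero, g divides f/x, which is a_h q(x) plus a polynomial of degree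
below k - 1 without x^(h-1) term. Reducing mod g and reading off x^(h-1) gives a_h r_{h-1} = 0; then
f/x is itself of degree below deg g. -/
theorem eq_zero_of_eval_eq_zero_of_rCoeff_ne_zero (hinj : Function.Injective α)
    (hα0 : ∀ i, α i ≠ 0) (hkn : k ≤ n) (hh : 1 ≤ (h : ℕ)) (hr : rCoeff k h α η ≠ 0)
    {a : Fin k → F} (ha0 : a ⟨0, h.pos⟩ = 0)
    (hf : ∀ i : Fin n, (i : ℕ) + 1 ≤ k - 1 → (twistedPoly h η a).eval (α i) = 0) : a = 0 := by
  have hk : 0 < k := h.pos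
  have hX : X * (twistedPoly h η a).divX = twistedPoly h η a := by
    have h1 := X_mul_divX_add (twistedPoly h η a)
    have h2 := coeff_twistedPoly_of_lt h η a ⟨0, hk⟩
    rw [ha0] at h2
    simpa only [show (twistedPoly h η a).coeff 0 = 0 from h2, C_0, add_zero] using h1
  have hdvd : gPoly k α ∣ (twistedPoly h η a).divX := by
    refine prod_X_sub_C_dvd_of_eval_eq_zero hinj fun i hi => ?_
    have h1 := hf i (Finset.mem_filter.1 hi).2
    rw [← hX, eval_mul, eval_X] at h1
    exact (mul_eq_zero.1 h1).resolve_left (hα0 i)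
  have hgm : (gPoly k α).Monic := monic_prod_of_monic _ _ fun i _ => monic_X_sub_C _
  have hlow : ∀ b : Fin k → F, b h = 0 → (twistedPoly h η b).divX.degree < (gPoly k α).degree := by
    intro b hb
    rw [degree_eq_natDegree hgm.ne_zero, natDegree_gPoly hkn, degree_lt_iff_coeff_zero]
    intro m hm
    rw [coeff_divX]
    exact coeff_eq_zero_of_natDegree_lt
      ((natDegree_twistedPoly_lt h η b hb).trans_le (by omega))
  have hah : a h = 0 := by
    set b : Fin k → F := a - Pi.single h (a h) with hb
    have hbh : b h = 0 := by simp [hb]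
    have hsingle : twistedPoly h η (Pi.single h (a h)) = C (a h) * (X * qPoly k h η) := by
      rw [X_mul_qPoly hh, mul_add]
      change (∑ i : Fin k, C ((Pi.single h (a h) : Fin k → F) i) * X ^ (i : ℕ)
        + C ((Pi.single h (a h) : Fin k → F) h) * ∑ t : Fin (l + 1), C (η t) * X ^ (k + (t : ℕ))) = _
      rw [Pi.single_eq_same, Finset.sum_eq_single h]
      · rw [Pi.single_eq_same]
      · intro i _ hi
        rw [Pi.single_eq_of_ne hi, C_0, zero_mul]
      · simp
    have hdiv : (twistedPoly h η a).divX = (twistedPoly h η b).divX + C (a h) * qPoly k h η := by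
      have h1 : twistedPoly h η a = twistedPoly h η b + X * (C (a h) * qPoly k h η) := by
        rw [hb, map_sub, hsingle]
        ring
      ext j
      rw [h1, divX_add, coeff_add, coeff_add, coeff_divX (p := X * _), coeff_X_mul]
    have hmod := (EuclideanDomain.mod_eq_zero.2 hdvd)
    rw [hdiv, add_mod, (mod_eq_self_iff hgm.ne_zero).2 (hlow b hbh), ← smul_eq_C_mul,
      ← modByMonic_eq_mod _ hgm, smul_modByMonic, modByMonic_eq_mod _ hgm] at hmod
    have hco := congrArg (fun p => coeff p ((h : ℕ) - 1)) hmod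
    simp only [coeff_add, coeff_smul, coeff_divX, coeff_zero, Nat.sub_add_cancel hh,
      coeff_twistedPoly_of_lt, hbh, zero_add, smul_eq_mul] at hco
    exact (mul_eq_zero.1 hco).resolve_right hr
  refine eq_zero_of_twistedPoly_eq_zero h η a ?_
  rw [← hX, eq_zero_of_dvd_of_degree_lt hdvd (hlow a hah), mul_zero]

end Zeros

/-! ### Dimension, minimum distance and hull of the code -/

section Code

variable {F : Type*} [Field F] {n k l : ℕ} {α v : Fin n → F} {h : Fin k} {η : Fin (l + 1) → F}

theorem mem_code {x : Fin n → F} :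
    x ∈ code α v h η ↔ ∃ a, evalMap α v (twistedPoly h η a) = x := by
  rw [code, ← range_twistedPoly, Submodule.mem_map]
  simp

theorem finrank_code (hker : ∀ a, evalMap α v (twistedPoly h η a) = 0 → a = 0) :
    Module.finrank F (code α v h η) = k := by
  have h1 : code α v h η = LinearMap.range ((evalMap α v).comp (twistedPoly h η)) := by
    rw [LinearMap.range_comp, range_twistedPoly, code]
  rw [h1, LinearMap.finrank_range_of_inj ((injective_iff_map_eq_zero _).2 hker),
    Module.finrank_fin_fun]

variable [DecidableEq F]

theorem card_zeros_lt (hinj : Function.Injective α) (hv : ∀ i, v i ≠ 0) (hkn : k < n)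
    (hη : η ∈ Phi k l h α) {a : Fin k → F} (ha : a ≠ 0) :
    (Finset.univ.filter fun i => evalMap α v (twistedPoly h η a) i = 0).card < k := by
  by_contra! hle
  obtain ⟨I, hIs, hI⟩ := Finset.exists_subset_card_eq hle
  refine ha (eq_zero_of_eval_eq_zero_of_card hinj hkn hη hI fun i hi => ?_)
  exact (mul_eq_zero.1 (Finset.mem_filter.1 (hIs hi)).2).resolve_left (hv i)

theorem hammingNorm_add_card_zeros (x : Fin n → F) :
    (Finset.univ.filter fun i => x i = 0).card + hammingNorm x = n := by
  rw [hammingNorm, Finset.card_filter_add_card_filter_not, Finset.card_univ, Fintype.card_fin]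

theorem minDist_code (hinj : Function.Injective α) (hv : ∀ i, v i ≠ 0) (hkn : k < n)
    (hη : η ∈ Phi k l h α) : minDist (code α v h η) = n - k + 1 := by
  have hk : 0 < k := h.pos
  have hge : ∀ a : Fin k → F, a ≠ 0 → n - k + 1 ≤ hammingNorm (evalMap α v (twistedPoly h η a)) := by
    intro a ha
    have h1 := card_zeros_lt hinj hv hkn hη ha
    have h2 := hammingNorm_add_card_zeros (evalMap α v (twistedPoly h η a))
    omega
  -- Restriction to k - 1 coordinates has a nontrivial kernel, which supplies a word of weight at
  -- most n - k + 1.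
  let T : (Fin k → F) →ₗ[F] (Fin (k - 1) → F) :=
    (LinearMap.funLeft F F (Fin.castLE (by omega : k - 1 ≤ n))).comp
      ((evalMap α v).comp (twistedPoly h η))
  obtain ⟨a, haT, ha⟩ := Submodule.exists_mem_ne_zero_of_ne_bot
    (LinearMap.ker_ne_bot_of_finrank_lt (f := T) (by
      rw [Module.finrank_fin_fun, Module.finrank_fin_fun]; omega))
  have hle : hammingNorm (evalMap α v (twistedPoly h η a)) ≤ n - k + 1 := by
    have h1 : k - 1 ≤ (Finset.univ.filter fun i => evalMap α v (twistedPoly h η a) i = 0).card := by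
      have := Finset.card_le_card_of_injOn (s := (Finset.univ : Finset (Fin (k - 1))))
        (t := Finset.univ.filter fun i => evalMap α v (twistedPoly h η a) i = 0)
        (Fin.castLE (by omega : k - 1 ≤ n))
        (fun i _ => by simpa [T] using congrFun (LinearMap.mem_ker.1 haT) i)
        (Fin.castLE_injective _).injOn
      simpa using this
    have h2 := hammingNorm_add_card_zeros (evalMap α v (twistedPoly h η a))
    omega
  refine le_antisymm (Nat.sInf_le ?_) (le_csInf ?_ ?_)
  · refine ⟨_, mem_code.2 ⟨a, rfl⟩, 0, Submodule.zero_mem _, fun h0 => ?_, ?_⟩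
    · have := hge a ha
      rw [h0, hammingNorm_zero] at this
      omega
    · rw [hammingDist_zero_right]
      exact le_antisymm hle (hge a ha)
  · refine ⟨_, _, mem_code.2 ⟨a, rfl⟩, 0, Submodule.zero_mem _, fun h0 => ?_, rfl⟩
    have := hge a ha
    rw [h0, hammingNorm_zero] at this
    omega
  · rintro d ⟨x, hx, y, hy, hxy, rfl⟩
    obtain ⟨b, hb⟩ := mem_code.1 (Submodule.add_mem _ (Submodule.neg_mem _ hx) hy)
    rw [hammingDist_eq_hammingNorm, ← hb]
    refine hge b ?_
    rintro rfl
    rw [map_zero, map_zero] at hb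
    exact hxy (neg_add_eq_zero.1 hb.symm)

omit [DecidableEq F] in
theorem isLCD_code [Fintype F] {lam : F} (hn : n ∣ Fintype.card F - 1)
    (hα : Set.range α = {x : F | (X ^ n - C lam : F[X]).IsRoot x})
    (hinj : Function.Injective α) (hα0 : ∀ i, α i ≠ 0) (hkn : 2 * (k + l) < n)
    (hh : 1 ≤ (h : ℕ))
    (hv_large : ∀ i : Fin n, k ≤ (i : ℕ) + 1 → v i * v i = 1)
    (hv_small : ∀ i : Fin n, (i : ℕ) + 1 ≤ k - 1 → v i * v i ≠ 1)
    (hr : rCoeff k h α η ≠ 0) : IsLCD (code α v h η) := by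
  have hk : 0 < k := h.pos
  rw [IsLCD, hull, eq_bot_iff]
  rintro x ⟨hx, hxd⟩
  obtain ⟨a, rfl⟩ := mem_code.1 hx
  suffices ha : a = 0 by simp [ha]
  have horth : ∀ b : Fin k → F, n * (b ⟨0, hk⟩ * a ⟨0, hk⟩) =
      ∑ i, (1 - v i * v i) * ((twistedPoly h η b).eval (α i) * (twistedPoly h η a).eval (α i)) := by
    intro b
    have h1 : ∑ i, v i * (twistedPoly h η b).eval (α i) * (v i * (twistedPoly h η a).eval (α i)) = 0 :=
      hxd _ (mem_code.2 ⟨b, rfl⟩)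
    have h2 := sum_eval_of_range_eq_roots hn hα hinj
      (p := twistedPoly h η b * twistedPoly h η a) (by
        have := natDegree_mul_le (p := twistedPoly h η b) (q := twistedPoly h η a)
        have := natDegree_twistedPoly_le h η a
        have := natDegree_twistedPoly_le h η b
        omega)
    rw [mul_coeff_zero] at h2
    have h3 := coeff_twistedPoly_of_lt h η a ⟨0, hk⟩
    have h4 := coeff_twistedPoly_of_lt h η b ⟨0, hk⟩
    dsimp only at h3 h4
    rw [h3, h4] at h2
    rw [← h2, ← sub_zero (∑ i, eval _ _), ← h1, ← Finset.sum_sub_distrib]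
    refine Finset.sum_congr rfl fun i _ => ?_
    rw [eval_mul]
    ring
  -- The k - 1 values at α_1, …, α_{k-1}, with the last slot holding the constant coefficient.
  let E : (Fin k → F) →ₗ[F] (Fin k → F) :=
    { toFun := fun b i => if (i : ℕ) + 1 = k then b ⟨0, hk⟩ else
        (twistedPoly h η b).eval (α (Fin.castLE (by omega) i))
      map_add' := fun b c => by
        funext i
        simp only [Pi.add_apply, map_add, eval_add]
        split_ifs <;> rfl
      map_smul' := fun c b => by
        funext i
        simp only [Pi.smul_apply, map_smul, eval_smul, RingHom.id_apply]
        split_ifs <;> rfl }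
  have hE : Function.Surjective E := by
    refine LinearMap.injective_iff_surjective.1 ((injective_iff_map_eq_zero E).2 fun b hb => ?_)
    refine eq_zero_of_eval_eq_zero_of_rCoeff_ne_zero hinj hα0 (by omega) hh hr ?_ fun i hi => ?_
    · simpa [E, show k - 1 + 1 = k by omega] using congrFun hb ⟨k - 1, by omega⟩
    · have h1 := congrFun hb ⟨i, by omega⟩
      simpa [E, show (i : ℕ) + 1 ≠ k by omega] using h1
  have hsmall : ∀ i : Fin n, (i : ℕ) + 1 ≤ k - 1 → (twistedPoly h η a).eval (α i) = 0 := by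
    intro j hj
    -- Testing against the dual basis vector at j isolates the single term (1 - v_j²) f_a(α_j).
    obtain ⟨b, hb⟩ := hE (Pi.single ⟨j, by omega⟩ 1)
    have hb0 : b ⟨0, hk⟩ = 0 := by
      have h1 := congrFun hb ⟨k - 1, by omega⟩
      rw [Pi.single_eq_of_ne (fun he => by have := congrArg Fin.val he; dsimp at this; omega)] at h1
      simpa [E, show k - 1 + 1 = k by omega] using h1
    have hbi : ∀ i : Fin n, (i : ℕ) + 1 ≤ k - 1 →
        (twistedPoly h η b).eval (α i) = if i = j then 1 else 0 := by
      intro i hi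
      have h1 := congrFun hb ⟨i, by omega⟩
      rw [Pi.single_apply] at h1
      simpa [E, show (i : ℕ) + 1 ≠ k by omega, Fin.val_inj] using h1
    have h2 := horth b
    rw [hb0, zero_mul, mul_zero, Finset.sum_eq_single j] at h2
    · rw [hbi j hj, if_pos rfl, one_mul] at h2
      exact (mul_eq_zero.1 h2.symm).resolve_left (sub_ne_zero.2 (hv_small j hj).symm)
    · intro i _ hij
      by_cases hi : (i : ℕ) + 1 ≤ k - 1
      · rw [hbi i hi, if_neg hij, zero_mul, mul_zero]
      · rw [hv_large i (by omega), sub_self, zero_mul]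
    · simp
  refine eq_zero_of_eval_eq_zero_of_rCoeff_ne_zero hinj hα0 (by omega) hh hr ?_ hsmall
  -- All terms on the right now vanish, so a test vector with constant term 1 leaves n a_0 = 0.
  have h2 := horth (Pi.single ⟨0, hk⟩ 1)
  rw [Pi.single_eq_same, one_mul, Finset.sum_eq_zero] at h2
  · exact (mul_eq_zero.1 h2).resolve_left (natCast_ne_zero_of_dvd_card_sub_one hn)
  · intro i _
    by_cases hi : (i : ℕ) + 1 ≤ k - 1
    · rw [hsmall i hi, mul_zero, mul_zero]
    · rw [hv_large i (by omega), sub_self, zero_mul]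

end Code

end TGRS

theorem mainTheorem5 {F : Type*} [Field F] [Fintype F] [DecidableEq F]
    (n k l : ℕ) (hk : 2 ≤ k) (hkn : (k : ℝ) ≤ ((n : ℝ) - 2 * (l : ℝ) - 1) / 2)
    (hn : n ∣ Fintype.card F - 1)
    (h : Fin k) (hh : 1 ≤ (h : ℕ))
    (lam : F) (hlam : lam ≠ 0) (hord : orderOf lam ∣ (Fintype.card F - 1) / n)
    (α v : Fin n → F)
    (hα : Set.range α = {x : F | (Polynomial.X ^ n - Polynomial.C lam).IsRoot x})
    (hv_large : ∀ i : Fin n, k ≤ (i : ℕ) + 1 → v i = 1 ∨ v i = -1)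
    (hv_small : ∀ i : Fin n, (i : ℕ) + 1 ≤ k - 1 → v i ≠ -1 ∧ v i ≠ 0 ∧ v i ≠ 1)
    (η : Fin (l + 1) → F)
    (hr : TGRS.rCoeff k h α η ≠ 0)
    (hη : η ∈ TGRS.Phi k l h α) :
    Module.finrank F (TGRS.code α v h η) = k ∧
      TGRS.IsLCD (TGRS.code α v h η) ∧ TGRS.IsMDS (TGRS.code α v h η) := by
  have hlen : 2 * (k + l) < n := by
    have h1 : ((2 * (k + l) + 1 : ℕ) : ℝ) ≤ (n : ℝ) := by
      push_cast
      linarith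
    exact Nat.lt_of_succ_le (by exact_mod_cast h1)
  have hkn' : k < n := by omega
  have hinj := TGRS.injective_of_range_eq_roots hn hlam hord hα
  have hα0 : ∀ i, α i ≠ 0 := fun i hi => hlam (by
    rw [← TGRS.pow_eq_of_range_eq_roots hα i, hi, zero_pow (by omega)])
  have hv0 : ∀ i, v i ≠ 0 := by
    intro i
    by_cases hi : k ≤ (i : ℕ) + 1
    · rcases hv_large i hi with h1 | h1 <;> simp [h1]
    · exact (hv_small i (by omega)).2.1
  have hdim : Module.finrank F (TGRS.code α v h η) = k := by
    refine TGRS.finrank_code fun a ha => ?_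
    by_contra ha0
    have h1 := TGRS.card_zeros_lt hinj hv0 hkn' hη ha0
    have h2 := TGRS.hammingNorm_add_card_zeros (TGRS.evalMap α v (TGRS.twistedPoly h η a))
    rw [ha, hammingNorm_zero] at h2
    rw [ha] at h1
    omega
  refine ⟨hdim, ?_, ?_⟩
  · refine TGRS.isLCD_code hn hα hinj hα0 hlen hh ?_ ?_ hr
    · intro i hi
      rcases hv_large i hi with h1 | h1 <;> simp [h1]
    · intro i hi h1
      rcases mul_self_eq_one_iff.1 h1 with h2 | h2
      · exact (hv_small i hi).2.2 h2
      · exact (hv_small i hi).1 h2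
  · rw [TGRS.IsMDS, TGRS.minDist_code hinj hv0 hkn' hη, hdim]
    omega
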